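/- Let $B,U,W,L\ge 1$ be integers with $L\le W$, let $\delta,\sigma\in\mathbb R$ with $\delta^2\le 1$ and $\sigma\ge 0$, and let $R=(1-\delta)I_B+\delta\mathbf 1_B$ be the $B\times B$ matrix with ones on the diagonal and $\delta$ elsewhere. Let $R^{1/2}$ be a complex $B\times B$ matrix with $(R^{1/2})^2=R$ (for instance the positive semidefinite square root when $R$ is positive semidefinite). Let $X_0,\dots,X_{L-1}$ and $E_0,\dots,E_{W-1}$ be random complex $B\times U$ matrices, all of whose entries are mutually independent, the entries of the $X_\ell$ being $\mathcal{CN}(0,1/(BL))$ and those of the $E_\omega$ being $\mathcal{CN}(0,1)$ (circularly symmetric complex Gaussian). For each subcarrier $\omega\in\{0,\dots,W-1\}$ put $$H_\omega=\sum_{\ell=0}^{L-1}R^{1/2}X_\ell\,e^{-j2\pi\omega\ell/W}+\sigma E_\omega,\qquad G_\omega=H_\omega^HH_\omega,$$ and let $\varepsilon_{\mathrm{CSI}}=2\sigma^2(2+B\sigma^2)$. Let $p_0<p_1<\dots<p_K$ be base points in $\{0,\dots,W-1\}$ with $K\ge1$, let $0\le k<K$, let $d_k=p_{k+1}-p_k$,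 and let $\omega$ be a subcarrier with $p_k<\omega<p_{k+1}$. The 0th-order interpolant at $\omega$ is $\widetilde G^{(0)}_\omega=G_p$, where $p$ is a base point minimizing $|p-\omega|$ (either choice in case of a tie). The 1st-order interpolant is $\widetilde G^{(1)}_\omega=\lambda_\omega G_{p_k}+(1-\lambda_\omega)G_{p_{k+1}}$ with $\lambda_\omega=(p_{k+1}-\omega)/(p_{k+1}-p_k)$. For $o\in\{0,1\}$ and $1\le m,n\le U$ let $$o\text{-}\mathsf{MSE}^{(m,n)}_\omega=\mathbb E\Big[\big|[\widetilde G^{(o)}_\omega]_{m,n}-[G_\omega]_{m,n}\big|^2\Big].$$ If $d_k\le W/(3L)$, then for every subcarrier $\omega$ with $p_k<\omega<p_{k+1}$ and all $m,n$, $$1\text{-}\mathsf{MSE}^{(m,n)}_\omega\le 0\text{-}\mathsf{MSE}^{(m,n)}_\omega,$$ and, for each such $\omega,m,n$, equality holds if and only if $L=1$ and $\varepsilon_{\mathrm{CSI}}=0$. -/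

import Mathlib

open MeasureTheory ProbabilityTheory
open scoped NNReal Matrix

/-- The circularly-symmetric complex Gaussian law `CN(0, v)`: real and imaginary parts are
independent real Gaussians with mean `0` and variance `v / 2`. -/
noncomputable def complexGaussian (v : ℝ≥0) : Measure ℂ :=
  ((gaussianReal 0 (v / 2)).prod (gaussianReal 0 (v / 2))).map
    Complex.measurableEquivRealProd.symm

/-- The `B × B` receive correlation matrix `(1 - δ) I + δ 1` with ones on the diagonal and `δ`
off the diagonal. -/
noncomputable def corrMatrix (B : ℕ) (δ : ℝ) : Matrix (Fin B) (Fin B) ℂ :=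
  Matrix.of fun a b => if a = b then 1 else (δ : ℂ)

/-- The (estimated) frequency-domain channel matrix on subcarrier `ω`,
`∑ ℓ < L, S X_ℓ exp (-j 2 π ω ℓ / W) + σ E_ω`, where `S` is a square root of the correlation matrix,
`X_ℓ` are the uncorrelated time-domain taps and `E_ω` is the channel-estimation error. -/
noncomputable def freqChannel {B U W L : ℕ} (S : Matrix (Fin B) (Fin B) ℂ) (σ : ℝ)
    (X : Fin L → Matrix (Fin B) (Fin U) ℂ) (E : Fin W → Matrix (Fin B) (Fin U) ℂ) (ω : Fin W) :
    Matrix (Fin B) (Fin U) ℂ :=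
  ∑ ℓ : Fin L,
      Complex.exp (-(Complex.I * 2 * Real.pi * (ω.val : ℂ) * (ℓ.val : ℂ) / (W : ℂ))) • (S * X ℓ)
    + (σ : ℂ) • E ω

/-- The Gram matrix `H_ωᴴ H_ω` on subcarrier `ω`. -/
noncomputable def gram {B U W L : ℕ} (S : Matrix (Fin B) (Fin B) ℂ) (σ : ℝ)
    (X : Fin L → Matrix (Fin B) (Fin U) ℂ) (E : Fin W → Matrix (Fin B) (Fin U) ℂ) (ω : Fin W) :
    Matrix (Fin U) (Fin U) ℂ :=
  (freqChannel S σ X E ω)ᴴ * freqChannel S σ X E ω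

/-- The statistical model: the entries of the taps `X_ℓ` are `CN(0, 1/(BL))`, the entries of the
estimation errors `E_ω` are `CN(0, 1)`, and all these entries are mutually independent. -/
structure IsChannelModel {Ω : Type*} [MeasurableSpace Ω] (P : Measure Ω) {B U W L : ℕ}
    (X : Fin L → Ω → Matrix (Fin B) (Fin U) ℂ) (E : Fin W → Ω → Matrix (Fin B) (Fin U) ℂ) :
    Prop where
  law_tap : ∀ ℓ b u, HasLaw (fun s => X ℓ s b u) (complexGaussian (1 / ((B : ℝ≥0) * (L : ℝ≥0)))) P
  law_err : ∀ ω b u, HasLaw (fun s => E ω s b u) (complexGaussian 1) P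
  indep : iIndepFun
    (fun (i : (Fin L × Fin B × Fin U) ⊕ (Fin W × Fin B × Fin U)) (s : Ω) =>
      Sum.elim (fun t => X t.1 s t.2.1 t.2.2) (fun t => E t.1 s t.2.1 t.2.2) i) P

/-- The base point `p i` is a nearest one to the subcarrier `ω`: `i` minimizes `|p i - ω|`. -/
def IsNearest {K W : ℕ} (p : Fin K → Fin W) (ω : Fin W) (i : Fin K) : Prop :=
  ∀ i' : Fin K, |((p i).val : ℤ) - (ω.val : ℤ)| ≤ |((p i').val : ℤ) - (ω.val : ℤ)|

/-- Linear interpolation, on subcarrier `ω`, of the matrices `G a` and `G b`: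
`lam • G a + (1 - lam) • G b` with `lam = (b - ω) / (b - a)`. -/
noncomputable def linInterp {U W : ℕ} (G : Fin W → Matrix (Fin U) (Fin U) ℂ) (a b ω : Fin W) :
    Matrix (Fin U) (Fin U) ℂ :=
  let lam : ℝ := ((b.val : ℝ) - (ω.val : ℝ)) / ((b.val : ℝ) - (a.val : ℝ))
  (lam : ℂ) • G a + ((1 - lam : ℝ) : ℂ) • G b

/-- The mean-squared error of the `(m, n)` entry of the random matrix `G'` as an approximation of
the random matrix `G`. -/
noncomputable def entryMSE {Ω : Type*} [MeasurableSpace Ω] (P : Measure Ω) {U : ℕ}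
    (G' G : Ω → Matrix (Fin U) (Fin U) ℂ) (m n : Fin U) : ℝ :=
  ∫ s, ‖G' s m n - G s m n‖ ^ 2 ∂P

/-- MSE on subcarrier `ω` of 0th order interpolation from the base point `q`. -/
noncomputable def mseZero {Ω : Type*} [MeasurableSpace Ω] (P : Measure Ω) {B U W L : ℕ}
    (S : Matrix (Fin B) (Fin B) ℂ) (σ : ℝ)
    (X : Fin L → Ω → Matrix (Fin B) (Fin U) ℂ) (E : Fin W → Ω → Matrix (Fin B) (Fin U) ℂ)
    (q ω : Fin W) (m n : Fin U) : ℝ :=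
  entryMSE P (fun s => gram S σ (fun ℓ => X ℓ s) (fun v => E v s) q)
    (fun s => gram S σ (fun ℓ => X ℓ s) (fun v => E v s) ω) m n

/-- MSE on subcarrier `ω` of 1st order interpolation between the base points `a` and `b`. -/
noncomputable def mseOne {Ω : Type*} [MeasurableSpace Ω] (P : Measure Ω) {B U W L : ℕ}
    (S : Matrix (Fin B) (Fin B) ℂ) (σ : ℝ)
    (X : Fin L → Ω → Matrix (Fin B) (Fin U) ℂ) (E : Fin W → Ω → Matrix (Fin B) (Fin U) ℂ)
    (a b ω : Fin W) (m n : Fin U) : ℝ :=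
  entryMSE P (fun s => linInterp (gram S σ (fun ℓ => X ℓ s) (fun v => E v s)) a b ω)
    (fun s => gram S σ (fun ℓ => X ℓ s) (fun v => E v s) ω) m n

/-- The CSI error term `2 σ² (2 + B σ²)`. -/
noncomputable def epsCSI (B : ℕ) (σ : ℝ) : ℝ := 2 * σ ^ 2 * (2 + B * σ ^ 2)

/-! Channel entries are linear forms in independent circular Gaussians, so Wick's formula computes
the second moments of Gram entries. They equal a constant independent of the subcarriers plus
`gramCov`: `F(ω - ω') * Q` for distinct subcarriers and `Q + e` on the diagonal, with `F` =
`fejerCorr`, `Q` = `corrEnergy > 0`, `e` = `errPower ≥ 0`. Interpolation errors have weights of sum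
zero, so the constant cancels and each MSE is a quadratic form in `gramCov`.

Let `a`, `b` be the distances from `ω` to its left and right base points and `t = b / (a + b)`. If
`a ≤ b`, the 0th-order MSE minus the 1st-order MSE is `2 t (1 - t) e + 2 (1 - t) Q (t (1 - F(a + b))
- (F a - F b))`; if `b ≤ a`, exchange `a` with `b` and `t` with `1 - t`. Since `F` is an average of
cosines, the last bracket is treated frequency by frequency (`cos_sub_cos_lt`), which reduces to
`sin ((2t - 1) u) < t sin u` for `0 < u ≤ π/3`; the spacing bound `W / (3L)` ensures this range.
Both summands are nonnegative. The first vanishes iff `σ = 0`, the second iff there is no nonzero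
frequency, that is `L = 1`. -/

/-! ### Moments of real Gaussians -/

lemma integral_sq_gaussianReal (v : ℝ≥0) : ∫ x, x ^ 2 ∂gaussianReal 0 v = v := by
  have h := variance_fun_id_gaussianReal (μ := 0) (v := v)
  rw [variance_eq_integral (by fun_prop)] at h
  simpa [integral_id_gaussianReal] using h

lemma integrable_pow_gaussianReal (v : ℝ≥0) (k : ℕ) :
    Integrable (fun x : ℝ => x ^ k) (gaussianReal 0 v) := by
  rcases Nat.eq_zero_or_pos k with rfl | hk
  · simp
  have h := (memLp_id_gaussianReal' (μ := 0) (v := v) (k : ENNReal) (by simp)).integrable_norm_pow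
    (by omega)
  refine h.mono (by fun_prop) (Filter.Eventually.of_forall fun x => ?_)
  simp

/-- The fourth moment, from the stability of centred Gaussians under convolution. -/
lemma integral_pow_four_gaussianReal (v : ℝ≥0) :
    ∫ x, x ^ 4 ∂gaussianReal 0 v = 3 * (v : ℝ) ^ 2 := by
  have hconv : (gaussianReal 0 v) ∗ (gaussianReal 0 v)
      = (gaussianReal 0 v).map (fun x => √2 * x) := by
    rw [gaussianReal_conv_gaussianReal, gaussianReal_map_const_mul]
    congr 1
    · simp
    · ext; simp; ring
  -- With `m` the fourth moment, the sum of two independent copies has fourth moment `4m` by scaling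
  -- and `2m + 6v²` by expansion.
  have h1 : ∫ x, x ^ 4 ∂((gaussianReal 0 v) ∗ (gaussianReal 0 v))
      = 4 * ∫ x, x ^ 4 ∂gaussianReal 0 v := by
    rw [hconv, integral_map (by fun_prop) (by fun_prop), ← integral_const_mul]
    congr with x
    have : √2 ^ 4 = 4 := by
      rw [show (4 : ℕ) = 2 * 2 by rfl, pow_mul, Real.sq_sqrt (by norm_num)]; norm_num
    rw [mul_pow, this]
  have hodd (k : ℕ) (hk : Odd k) : ∫ x, x ^ k ∂gaussianReal 0 v = 0 := by
    have : ∫ x, x ^ k ∂gaussianReal 0 v = -∫ x, x ^ k ∂gaussianReal 0 v := by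
      conv_lhs => rw [← neg_zero, ← gaussianReal_map_neg,
        integral_map (by fun_prop) (by fun_prop)]
      simp_rw [hk.neg_pow]
      rw [integral_neg]
    linarith
  have hi (k l : ℕ) : Integrable (fun z : ℝ × ℝ => z.1 ^ k * z.2 ^ l)
      ((gaussianReal 0 v).prod (gaussianReal 0 v)) :=
    (integrable_pow_gaussianReal v k).mul_prod (integrable_pow_gaussianReal v l)
  have hm (k l : ℕ) : ∫ z : ℝ × ℝ, z.1 ^ k * z.2 ^ l ∂((gaussianReal 0 v).prod (gaussianReal 0 v))
      = (∫ x, x ^ k ∂(gaussianReal 0 v)) * ∫ x, x ^ l ∂(gaussianReal 0 v) :=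
    integral_prod_mul (fun x : ℝ => x ^ k) (fun x : ℝ => x ^ l)
  have h2 : ∫ x, x ^ 4 ∂((gaussianReal 0 v) ∗ (gaussianReal 0 v))
      = 2 * (∫ x, x ^ 4 ∂gaussianReal 0 v) + 6 * (v : ℝ) ^ 2 := by
    rw [Measure.conv, integral_map (by fun_prop) (by fun_prop)]
    have (z : ℝ × ℝ) : (z.1 + z.2) ^ 4 = z.1 ^ 4 * z.2 ^ 0 + 4 * (z.1 ^ 3 * z.2 ^ 1)
        + 6 * (z.1 ^ 2 * z.2 ^ 2) + 4 * (z.1 ^ 1 * z.2 ^ 3) + z.1 ^ 0 * z.2 ^ 4 := by ring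
    simp_rw [this]
    rw [integral_add, integral_add, integral_add, integral_add, integral_const_mul,
      integral_const_mul, integral_const_mul]
    · simp_rw [hm]
      rw [hodd 3 (by decide), hodd 1 (by decide), integral_sq_gaussianReal]
      simp
      ring
    all_goals
      first
      | exact hi _ _
      | exact (hi _ _).const_mul _
      | skip
    · exact (hi _ _).add ((hi _ _).const_mul _)
    · exact ((hi _ _).add ((hi _ _).const_mul _)).add ((hi _ _).const_mul _)
    · exact (((hi _ _).add ((hi _ _).const_mul _)).add ((hi _ _).const_mul _)).add
        ((hi _ _).const_mul _)
  linarith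

/-! ### Moments of circular complex Gaussians -/

instance isProbabilityMeasure_complexGaussian (v : ℝ≥0) :
    IsProbabilityMeasure (complexGaussian v) := by
  unfold complexGaussian
  exact Measure.isProbabilityMeasure_map (by fun_prop)

lemma integral_complexGaussian (v : ℝ≥0) (f : ℂ → ℂ) :
    ∫ z, f z ∂complexGaussian v = ∫ x, f ⟨x.1, x.2⟩
      ∂((gaussianReal 0 (v / 2)).prod (gaussianReal 0 (v / 2))) := by
  rw [complexGaussian, integral_map_equiv]
  rfl

/-- Multiplication by `i` swaps the two coordinates and negates one; they are i.i.d. and symmetric.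
-/
lemma complexGaussian_map_I_mul (v : ℝ≥0) :
    (complexGaussian v).map (fun z => Complex.I * z) = complexGaussian v := by
  unfold complexGaussian
  set μ := gaussianReal 0 (v / 2)
  have hμ : μ.map (fun x => -x) = μ := by simp [μ, gaussianReal_map_neg]
  rw [Measure.map_map (by fun_prop) (by fun_prop)]
  have h : (μ.prod μ).map (Prod.map (fun x => -x) id ∘ Prod.swap) = μ.prod μ := by
    rw [← Measure.map_map (by fun_prop) (by fun_prop), Measure.prod_swap,
      ← Measure.map_prod_map _ _ (by fun_prop) (by fun_prop), hμ, Measure.map_id]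
  conv_rhs => rw [← h, Measure.map_map (by fun_prop) (by fun_prop)]
  congr 1
  funext x
  apply Complex.ext <;> simp [Complex.measurableEquivRealProd]

lemma memLp_id_complexGaussian (v : ℝ≥0) (p : ℝ≥0) :
    MemLp (fun z : ℂ => z) p (complexGaussian v) := by
  unfold complexGaussian
  rw [memLp_map_measure_iff (by fun_prop) (by fun_prop)]
  have h := memLp_id_gaussianReal (μ := 0) (v := v / 2) p
  have h1 := h.comp_measurePreserving
    (measurePreserving_fst (μ := gaussianReal 0 (v / 2)) (ν := gaussianReal 0 (v / 2)))
  have h2 := h.comp_measurePreserving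
    (measurePreserving_snd (μ := gaussianReal 0 (v / 2)) (ν := gaussianReal 0 (v / 2)))
  refine (h1.ofReal (K := ℂ)).add ((h2.ofReal (K := ℂ)).mul_const Complex.I) |>.ae_eq ?_
  refine Filter.Eventually.of_forall fun x => ?_
  apply Complex.ext <;> simp [Complex.measurableEquivRealProd]

open ComplexConjugate

/-- Invariance under multiplication by `i` multiplies the moment by `i ^ (p - q)`, which is not `1`
because `0 < |p - q| ≤ 2`. -/
lemma integral_pow_mul_conj_pow_complexGaussian_of_ne (v : ℝ≥0) {p q : ℕ} (hp : p ≤ 2) (hq : q ≤ 2)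
    (hpq : p ≠ q) : ∫ z, z ^ p * conj z ^ q ∂complexGaussian v = 0 := by
  have h : ∫ z, z ^ p * conj z ^ q ∂complexGaussian v
      = (Complex.I ^ p * (-Complex.I) ^ q) * ∫ z, z ^ p * conj z ^ q ∂complexGaussian v := by
    conv_lhs => rw [← complexGaussian_map_I_mul]
    rw [integral_map (by fun_prop) (by fun_prop), ← integral_const_mul]
    congr with z
    simp only [map_mul, Complex.conj_I]
    ring
  have hne : Complex.I ^ p * (-Complex.I) ^ q ≠ 1 := by
    interval_cases p <;> interval_cases q <;> simp_all [Complex.ext_iff, pow_succ] <;> norm_num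
  have : (1 - Complex.I ^ p * (-Complex.I) ^ q) * ∫ z, z ^ p * conj z ^ q ∂complexGaussian v = 0 := by
    linear_combination h
  exact (mul_eq_zero.mp this).resolve_left (sub_ne_zero.mpr hne.symm)

lemma integral_mul_conj_complexGaussian (v : ℝ≥0) :
    ∫ z, z ^ 1 * conj z ^ 1 ∂complexGaussian v = (v : ℂ) := by
  rw [integral_complexGaussian]
  set μ := gaussianReal 0 (v / 2)
  have hi (k l : ℕ) : Integrable (fun z : ℝ × ℝ => z.1 ^ k * z.2 ^ l) (μ.prod μ) :=
    (integrable_pow_gaussianReal _ k).mul_prod (integrable_pow_gaussianReal _ l)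
  have hm (k l : ℕ) : ∫ z : ℝ × ℝ, z.1 ^ k * z.2 ^ l ∂(μ.prod μ)
      = (∫ x, x ^ k ∂μ) * ∫ x, x ^ l ∂μ :=
    integral_prod_mul (fun x : ℝ => x ^ k) (fun x : ℝ => x ^ l)
  have (x : ℝ × ℝ) : (⟨x.1, x.2⟩ : ℂ) ^ 1 * conj (⟨x.1, x.2⟩ : ℂ) ^ 1
      = ((x.1 ^ 2 * x.2 ^ 0 + x.1 ^ 0 * x.2 ^ 2 : ℝ) : ℂ) := by
    rw [pow_one, pow_one, Complex.mul_conj, Complex.normSq_mk]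
    congr 1; ring
  simp_rw [this]
  rw [integral_complex_ofReal, integral_add (hi _ _) (hi _ _)]
  simp_rw [hm]
  simp [μ, integral_sq_gaussianReal]

lemma integral_sq_mul_conj_sq_complexGaussian (v : ℝ≥0) :
    ∫ z, z ^ 2 * conj z ^ 2 ∂complexGaussian v = 2 * (v : ℂ) ^ 2 := by
  rw [integral_complexGaussian]
  set μ := gaussianReal 0 (v / 2)
  have hi (k l : ℕ) : Integrable (fun z : ℝ × ℝ => z.1 ^ k * z.2 ^ l) (μ.prod μ) :=
    (integrable_pow_gaussianReal _ k).mul_prod (integrable_pow_gaussianReal _ l)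
  have hm (k l : ℕ) : ∫ z : ℝ × ℝ, z.1 ^ k * z.2 ^ l ∂(μ.prod μ)
      = (∫ x, x ^ k ∂μ) * ∫ x, x ^ l ∂μ :=
    integral_prod_mul (fun x : ℝ => x ^ k) (fun x : ℝ => x ^ l)
  have (x : ℝ × ℝ) : (⟨x.1, x.2⟩ : ℂ) ^ 2 * conj (⟨x.1, x.2⟩ : ℂ) ^ 2
      = ((x.1 ^ 4 * x.2 ^ 0 + 2 * (x.1 ^ 2 * x.2 ^ 2) + x.1 ^ 0 * x.2 ^ 4 : ℝ) : ℂ) := by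
    rw [← mul_pow, Complex.mul_conj, Complex.normSq_mk, ← Complex.ofReal_pow]
    congr 1; ring
  simp_rw [this]
  have h1 := hi 4 0
  have h2 := (hi 2 2).const_mul 2
  have h3 := h1.add h2
  simp only [Pi.add_def] at h3
  rw [integral_complex_ofReal, integral_add h3 (hi _ _), integral_add h1 h2, integral_const_mul]
  simp_rw [hm]
  simp [μ, integral_sq_gaussianReal, integral_pow_four_gaussianReal]
  ring

/-! ### Integrability of polynomial expressions -/

/-- A complex random variable all of whose absolute moments are finite. -/
def HasAllMoments {Ω : Type*} [MeasurableSpace Ω] (P : Measure Ω) (f : Ω → ℂ) : Prop :=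
  ∀ p : ℝ≥0, MemLp f p P

namespace HasAllMoments

variable {Ω : Type*} [MeasurableSpace Ω] {P : Measure Ω} {f g : Ω → ℂ}

/-- Hölder with exponents `2p`, `2p`, `p`. Asking for every exponent makes the class stable under
products. -/
lemma mul (hf : HasAllMoments P f) (hg : HasAllMoments P g) :
    HasAllMoments P (fun s => f s * g s) := by
  intro p
  have h : ENNReal.HolderTriple ((2 * p : ℝ≥0) : ENNReal) ((2 * p : ℝ≥0) : ENNReal) p := by
    constructor
    rw [ENNReal.coe_mul, ENNReal.mul_inv (by simp) (by simp), ← add_mul]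
    simp [ENNReal.inv_two_add_inv_two]
  exact (hg (2 * p)).mul (hf (2 * p))

lemma add (hf : HasAllMoments P f) (hg : HasAllMoments P g) :
    HasAllMoments P (fun s => f s + g s) :=
  fun p => (hf p).add (hg p)

lemma const_mul (c : ℂ) (hf : HasAllMoments P f) : HasAllMoments P (fun s => c * f s) :=
  fun p => (hf p).const_mul c

lemma conj_comp (hf : HasAllMoments P f) : HasAllMoments P (fun s => conj (f s)) :=
  fun p => (hf p).star

lemma sum {ι : Type*} (t : Finset ι) {f : ι → Ω → ℂ} (hf : ∀ i ∈ t, HasAllMoments P (f i)) :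
    HasAllMoments P (fun s => ∑ i ∈ t, f i s) :=
  fun p => memLp_finsetSum t fun i hi => hf i hi p

lemma integrable (hf : HasAllMoments P f) : Integrable f P := by
  have := hf 1
  rw [ENNReal.coe_one, memLp_one_iff_integrable] at this
  exact this

end HasAllMoments

lemma hasAllMoments_of_hasLaw {Ω : Type*} [MeasurableSpace Ω] {P : Measure Ω} {f : Ω → ℂ}
    {v : ℝ≥0} (hf : HasLaw f (complexGaussian v) P) : HasAllMoments P f := fun p => by
  have h := memLp_id_complexGaussian v p
  rw [← hf.map_eq] at h
  exact h.comp_of_map hf.aemeasurable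

/-! ### Wick's formula -/

section Wick

variable {Ω : Type*} [MeasurableSpace Ω] {P : Measure Ω} {ι : Type*} [Fintype ι]
  {Z : ι → Ω → ℂ} {v : ι → ℝ≥0}

/-- The covariance `E[conj (∑ α i Z i) (∑ β i Z i)]` of two linear forms in independent circularly
symmetric variables `Z i` of variances `v i`. -/
noncomputable def formCov (v : ι → ℝ≥0) (α β : ι → ℂ) : ℂ := ∑ i, conj (α i) * β i * v i

lemma hasAllMoments_linearForm (hlaw : ∀ i, HasLaw (Z i) (complexGaussian (v i)) P) (α : ι → ℂ) :
    HasAllMoments P (fun s => ∑ i, α i * Z i s) :=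
  .sum _ fun i _ => (hasAllMoments_of_hasLaw (hlaw i)).const_mul _

variable [DecidableEq ι]

lemma prod_pow_ite_eq (f : ι → ℂ) (j : ι) : ∏ t, f t ^ (if t = j then 1 else 0) = f j := by
  simp

/-- Wick's formula for the fourth moments of independent complex Gaussians. -/
lemma integral_conj_mul_mul_mul_conj (hind : iIndepFun Z P)
    (hlaw : ∀ i, HasLaw (Z i) (complexGaussian (v i)) P) (i j k l : ι) :
    ∫ s, conj (Z i s) * Z j s * (Z k s * conj (Z l s)) ∂P
      = (if i = j ∧ k = l then (v i : ℂ) * v k else 0)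
        + if i = k ∧ j = l then (v i : ℂ) * v j else 0 := by
  -- `p t` and `q t` count the plain and conjugated factors with index `t`. The expectation factors
  -- over `t` and vanishes unless `p = q`, i.e. unless `{j, k} = {i, l}` as multisets.
  set p : ι → ℕ := fun t => (if t = j then 1 else 0) + (if t = k then 1 else 0) with hp
  set q : ι → ℕ := fun t => (if t = i then 1 else 0) + (if t = l then 1 else 0) with hq
  have hp2 (t) : p t ≤ 2 := by simp only [hp]; split_ifs <;> omega
  have hq2 (t) : q t ≤ 2 := by simp only [hq]; split_ifs <;> omega
  have hprod (s : Ω) : conj (Z i s) * Z j s * (Z k s * conj (Z l s))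
      = ∏ t, (fun z : ℂ => z ^ p t * conj z ^ q t) (Z t s) := by
    simp only [hp, hq, pow_add, Finset.prod_mul_distrib, prod_pow_ite_eq (fun t => Z t s),
      prod_pow_ite_eq (fun t => conj (Z t s))]
    ring
  simp_rw [hprod]
  rw [hind.integral_fun_prod_comp (f := fun t z => z ^ p t * conj z ^ q t)
    (fun t => (hlaw t).aemeasurable) (fun t => by fun_prop)]
  have hm (t : ι) : ∫ s, Z t s ^ p t * conj (Z t s) ^ q t ∂P
      = ∫ z, z ^ p t * conj z ^ q t ∂complexGaussian (v t) := by
    rw [← (hlaw t).integral_comp (by fun_prop)]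
    rfl
  simp_rw [hm]
  have hzero (t : ι) (ht : p t ≠ q t) :
      ∏ t, ∫ z, z ^ p t * conj z ^ q t ∂complexGaussian (v t) = 0 :=
    Finset.prod_eq_zero (Finset.mem_univ t)
      (integral_pow_mul_conj_pow_complexGaussian_of_ne _ (hp2 t) (hq2 t) ht)
  have heq (hpq : p = q) : ∏ t, ∫ z, z ^ p t * conj z ^ q t ∂complexGaussian (v t)
      = if j = k then 2 * (v j : ℂ) ^ 2 else (v j : ℂ) * v k := by
    rw [← hpq]
    split_ifs with hjk
    · rw [Finset.prod_eq_single j]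
      · have : p j = 2 := by simp [hp, hjk]
        rw [this, integral_sq_mul_conj_sq_complexGaussian]
      · intro t _ ht
        have : p t = 0 := by simp [hp, ← hjk, ht]
        simp [this]
      · simp
    · have (t : ι) : ∫ z, z ^ p t * conj z ^ p t ∂complexGaussian (v t)
          = (v t : ℂ) ^ (if t = j then 1 else 0) * (v t : ℂ) ^ (if t = k then 1 else 0) := by
        by_cases h1 : t = j
        · have : p t = 1 := by simp [hp, h1, hjk]
          rw [this, integral_mul_conj_complexGaussian]
          simp [h1, hjk]
        · by_cases h2 : t = k
          · have : p t = 1 := by simp [hp, h2, Ne.symm hjk]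
            rw [this, integral_mul_conj_complexGaussian]
            simp [h2, Ne.symm hjk]
          · have : p t = 0 := by simp [hp, h1, h2]
            simp [this, h1, h2]
      simp_rw [this, Finset.prod_mul_distrib, prod_pow_ite_eq (fun t => (v t : ℂ))]
  -- When no pairing exists, some index has unequal counts: `k`, `j` or `i` according to the case.
  -- If all four indices agree, both pairings contribute, matching the moment `2 v²`.
  by_cases hij : i = j
  · by_cases hkl : k = l
    · rw [heq (by simp [hp, hq, hij, hkl])]
      subst hij hkl
      split_ifs <;> simp_all
      ring
    · rw [hzero k (by simp [hp, hq, hij, hkl])]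
      have : ¬ (i = k ∧ j = l) := by rintro ⟨rfl, rfl⟩; exact hkl hij
      simp [hkl, this]
  · by_cases hik : i = k
    · by_cases hjl : j = l
      · rw [heq (by funext t; simp [hp, hq, hik, hjl, add_comm])]
        subst hik hjl
        simp [hij, Ne.symm hij, mul_comm]
      · rw [hzero j (by simp [hp, hq, hjl, Ne.symm hij])]
        simp [hij, hjl]
    · rw [hzero i (by simp [hp, hq, hij, hik]; omega)]
      simp [hij, hik]

/-- Wick's formula for four linear forms in independent complex Gaussians. -/
lemma integral_linearForms (hind : iIndepFun Z P)
    (hlaw : ∀ i, HasLaw (Z i) (complexGaussian (v i)) P) (α β γ κ : ι → ℂ) :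
    ∫ s, conj (∑ i, α i * Z i s) * (∑ i, β i * Z i s)
        * ((∑ i, γ i * Z i s) * conj (∑ i, κ i * Z i s)) ∂P
      = formCov v α β * formCov v κ γ + formCov v α γ * formCov v κ β := by
  have hZ (i : ι) := hasAllMoments_of_hasLaw (hlaw i)
  have hexp (s : Ω) : conj (∑ i, α i * Z i s) * (∑ i, β i * Z i s)
        * ((∑ i, γ i * Z i s) * conj (∑ i, κ i * Z i s))
      = ∑ i, ∑ j, ∑ k, ∑ l, (conj (α i) * β j * γ k * conj (κ l))
          * (conj (Z i s) * Z j s * (Z k s * conj (Z l s))) := by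
    simp_rw [map_sum, Finset.sum_mul_sum]
    refine Finset.sum_congr rfl fun i _ => ?_
    rw [Finset.sum_comm]
    refine Finset.sum_congr rfl fun j _ => ?_
    refine Finset.sum_congr rfl fun k _ => ?_
    refine Finset.sum_congr rfl fun l _ => ?_
    simp only [map_mul]
    ring
  have hint (i j k l : ι) : HasAllMoments P fun s => (conj (α i) * β j * γ k * conj (κ l))
          * (conj (Z i s) * Z j s * (Z k s * conj (Z l s))) :=
    .const_mul _ (((hZ i).conj_comp.mul (hZ j)).mul ((hZ k).mul (hZ l).conj_comp))
  simp_rw [hexp]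
  rw [integral_finsetSum _ fun i _ => (HasAllMoments.sum _ fun j _ => .sum _ fun k _ =>
    .sum _ fun l _ => hint i j k l).integrable]
  simp_rw [integral_finsetSum _ fun j _ => (HasAllMoments.sum _ fun k _ =>
    .sum _ fun l _ => hint _ j k l).integrable]
  simp_rw [integral_finsetSum _ fun k _ => (HasAllMoments.sum _ fun l _ =>
    hint _ _ k l).integrable]
  simp_rw [integral_finsetSum _ fun l _ => (hint _ _ _ l).integrable, integral_const_mul,
    integral_conj_mul_mul_mul_conj hind hlaw, mul_add, Finset.sum_add_distrib]
  congr 1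
  · simp only [formCov, Finset.sum_mul_sum]
    refine Finset.sum_congr rfl fun i _ => ?_
    rw [Finset.sum_eq_single i (by intro j _ hj; simp [Ne.symm hj]) (by simp)]
    refine Finset.sum_congr rfl fun k _ => ?_
    simp
    ring
  · simp only [formCov, Finset.sum_mul_sum]
    refine Finset.sum_congr rfl fun i _ => ?_
    refine Finset.sum_congr rfl fun j _ => ?_
    rw [Finset.sum_eq_single i (by intro j _ hj; simp [Ne.symm hj]) (by simp)]
    simp
    ring

end Wick

/-! ### Covariances of channel and Gram entries -/

/-- The phase factor of tap `ℓ` on subcarrier `ω`. -/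
noncomputable def phase (W ω ℓ : ℕ) : ℂ :=
  Complex.exp (-(Complex.I * 2 * Real.pi * (ω : ℂ) * (ℓ : ℂ) / (W : ℂ)))

/-- The index set of all entries of the taps and of the estimation errors. -/
abbrev EntryIndex (B U W L : ℕ) := (Fin L × Fin B × Fin U) ⊕ (Fin W × Fin B × Fin U)

/-- The variances of the entries of the taps and of the estimation errors. -/
noncomputable def entryVar (B U W L : ℕ) : EntryIndex B U W L → ℝ≥0 :=
  Sum.elim (fun _ => 1 / ((B : ℝ≥0) * (L : ℝ≥0))) (fun _ => 1)

/-- The coefficients of the `(a, m)` entry of the channel matrix on subcarrier `ω` as a linear form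
in the entries of the taps and of the estimation errors. -/
noncomputable def channelCoef {B : ℕ} (U : ℕ) {W : ℕ} (L : ℕ) (S : Matrix (Fin B) (Fin B) ℂ) (σ : ℝ)
    (ω : Fin W) (a : Fin B) (m : Fin U) : EntryIndex B U W L → ℂ :=
  Sum.elim (fun t => phase W ω t.1 * S a t.2.1 * if t.2.2 = m then 1 else 0)
    (fun t => (σ : ℂ) * if t = (ω, a, m) then 1 else 0)

lemma freqChannel_apply {B U W L : ℕ} (S : Matrix (Fin B) (Fin B) ℂ) (σ : ℝ)
    (X : Fin L → Matrix (Fin B) (Fin U) ℂ) (E : Fin W → Matrix (Fin B) (Fin U) ℂ) (ω : Fin W)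
    (a : Fin B) (m : Fin U) :
    freqChannel S σ X E ω a m = ∑ i, channelCoef U L S σ ω a m i *
      Sum.elim (fun t => X t.1 t.2.1 t.2.2) (fun t => E t.1 t.2.1 t.2.2) i := by
  simp only [freqChannel, Matrix.add_apply, Matrix.sum_apply, Matrix.smul_apply, Matrix.mul_apply,
    smul_eq_mul, Fintype.sum_sum_type, channelCoef, Sum.elim_inl, Sum.elim_inr]
  congr 1
  · simp only [Fintype.sum_prod_type, Finset.mul_sum]
    refine Finset.sum_congr rfl fun ℓ _ => Finset.sum_congr rfl fun b _ => ?_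
    simp [phase, mul_assoc]
  · simp

/-- The matrix `conj S Sᵀ / B`. -/
noncomputable def normCorr {B : ℕ} (S : Matrix (Fin B) (Fin B) ℂ) (a b : Fin B) : ℂ :=
  (∑ c, conj (S a c) * S b c) / B

/-- The normalized correlation across subcarriers of a channel without estimation errors. -/
noncomputable def phaseCorr (W L ω ω' : ℕ) : ℂ :=
  (∑ ℓ : Fin L, conj (phase W ω ℓ) * phase W ω' ℓ) / L

/-- The covariance between the entries in rows `a` and `b` of a column of the channel matrices on
subcarriers `ω` and `ω'`. -/
noncomputable def channelCov {B W : ℕ} (L : ℕ) (S : Matrix (Fin B) (Fin B) ℂ) (σ : ℝ)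
    (ω ω' : Fin W) (a b : Fin B) : ℂ :=
  phaseCorr W L ω ω' * normCorr S a b + if ω = ω' ∧ a = b then (σ : ℂ) ^ 2 else 0

/-- Distinct columns use disjoint variables. In one column the tap sum separates into a sum over `ℓ`
and a sum over `c`, which absorb the factors `1/L` and `1/B`; an error is correlated only with
itself. -/
lemma formCov_channelCoef {B U W L : ℕ} (S : Matrix (Fin B) (Fin B) ℂ) (σ : ℝ) (ω ω' : Fin W)
    (a b : Fin B) (m n : Fin U) :
    formCov (entryVar B U W L) (channelCoef U L S σ ω a m) (channelCoef U L S σ ω' b n)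
      = if m = n then channelCov L S σ ω ω' a b else 0 := by
  simp only [formCov, Fintype.sum_sum_type, channelCoef, entryVar, Sum.elim_inl, Sum.elim_inr]
  have h1 : ∑ t : Fin L × Fin B × Fin U,
      conj (phase W ω t.1 * S a t.2.1 * if t.2.2 = m then 1 else 0)
        * (phase W ω' t.1 * S b t.2.1 * if t.2.2 = n then 1 else 0)
        * ((1 / ((B : ℝ≥0) * (L : ℝ≥0)) : ℝ≥0) : ℂ)
      = if m = n then phaseCorr W L ω ω' * normCorr S a b else 0 := by
    simp only [Fintype.sum_prod_type]
    by_cases hmn : m = n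
    · subst hmn
      simp only [if_true, phaseCorr, normCorr, div_mul_div_comm, Finset.sum_mul_sum,
        Finset.sum_div]
      refine Finset.sum_congr rfl fun ℓ _ => Finset.sum_congr rfl fun c _ => ?_
      rw [Finset.sum_eq_single m (by intro u _ hu; simp [hu]) (by simp)]
      simp only [map_mul, if_true, map_one]
      push_cast
      ring
    · rw [if_neg hmn]
      refine Finset.sum_eq_zero fun ℓ _ => Finset.sum_eq_zero fun c _ =>
        Finset.sum_eq_zero fun u _ => ?_
      by_cases hu : u = m
      · simp [hu, hmn]
      · simp [hu]
  have h2 : ∑ t : Fin W × Fin B × Fin U, conj ((σ : ℂ) * if t = (ω, a, m) then 1 else 0)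
        * ((σ : ℂ) * if t = (ω', b, n) then 1 else 0) * ((1 : ℝ≥0) : ℂ)
      = if m = n then (if ω = ω' ∧ a = b then (σ : ℂ) ^ 2 else 0) else 0 := by
    rw [Finset.sum_eq_single (ω, a, m) (by intro t _ ht; simp [ht]) (by simp)]
    by_cases h1 : ω = ω' <;> by_cases h2 : a = b <;> by_cases h3 : m = n <;>
      simp [h1, h2, h3, sq]
  rw [h1, h2, channelCov]
  split_ifs <;> simp

lemma conj_phaseCorr (W L ω ω' : ℕ) : conj (phaseCorr W L ω ω') = phaseCorr W L ω' ω := by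
  simp [phaseCorr, mul_comm]

lemma conj_normCorr {B : ℕ} (S : Matrix (Fin B) (Fin B) ℂ) (a b : Fin B) :
    conj (normCorr S a b) = normCorr S b a := by
  simp [normCorr, mul_comm]

lemma conj_channelCov {B W L : ℕ} (S : Matrix (Fin B) (Fin B) ℂ) (σ : ℝ) (ω ω' : Fin W)
    (a b : Fin B) : conj (channelCov L S σ ω ω' a b) = channelCov L S σ ω' ω b a := by
  simp only [channelCov, map_add, map_mul, conj_phaseCorr, conj_normCorr, eq_comm (a := ω'),
    eq_comm (a := b)]
  split_ifs <;> simp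

lemma conj_phase_mul_phase (W ω ω' ℓ : ℕ) : conj (phase W ω ℓ) * phase W ω' ℓ
    = Complex.exp ((2 * Real.pi * ((ω : ℝ) - ω') * ℓ / W : ℝ) * Complex.I) := by
  rw [phase, phase, ← Complex.exp_conj, ← Complex.exp_add]
  congr 1
  simp only [map_neg, map_div₀, map_mul, Complex.conj_I, Complex.conj_ofReal, map_ofNat,
    map_natCast]
  push_cast
  ring

lemma phaseCorr_self (W : ℕ) {L : ℕ} (hL : L ≠ 0) (ω : ℕ) : phaseCorr W L ω ω = 1 := by
  simp only [phaseCorr, conj_phase_mul_phase]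
  simp [hL]

/-- The squared magnitude of the correlation between subcarriers at distance `x`, as a double sum of
cosines (a normalized Fejér kernel). -/
noncomputable def fejerCorr (W L : ℕ) (x : ℝ) : ℝ :=
  (∑ ℓ : Fin L, ∑ ℓ' : Fin L, Real.cos (2 * Real.pi * ((ℓ : ℝ) - ℓ') / W * x)) / L ^ 2

lemma norm_sum_exp_sq {ι : Type*} [Fintype ι] (θ : ι → ℝ) :
    ‖∑ ℓ, Complex.exp (θ ℓ * Complex.I)‖ ^ 2 = ∑ ℓ, ∑ ℓ', Real.cos (θ ℓ - θ ℓ') := by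
  rw [← Complex.normSq_eq_norm_sq, Complex.normSq_apply, Complex.re_sum, Complex.im_sum]
  simp only [Complex.exp_ofReal_mul_I_re, Complex.exp_ofReal_mul_I_im, Finset.sum_mul_sum,
    ← Finset.sum_add_distrib, Real.cos_sub]

lemma norm_phaseCorr_sq (W L ω ω' : ℕ) :
    ‖phaseCorr W L ω ω'‖ ^ 2 = fejerCorr W L ((ω : ℝ) - ω') := by
  simp only [phaseCorr, conj_phase_mul_phase, norm_div, div_pow, norm_sum_exp_sq, fejerCorr,
    Complex.norm_natCast]
  congr 1
  refine Finset.sum_congr rfl fun ℓ _ => Finset.sum_congr rfl fun ℓ' _ => ?_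
  congr 1
  ring

/-- The energy `tr (Q²)` of the normalized correlation matrix `Q`. -/
noncomputable def corrEnergy {B : ℕ} (S : Matrix (Fin B) (Fin B) ℂ) : ℝ :=
  ∑ a, ∑ b, ‖normCorr S a b‖ ^ 2

/-- The contribution of the estimation errors to the power of the centred Gram entries. -/
noncomputable def errPower {B : ℕ} (S : Matrix (Fin B) (Fin B) ℂ) (σ : ℝ) : ℝ :=
  2 * σ ^ 2 * (∑ a, (∑ c, ‖S a c‖ ^ 2) / B) + B * σ ^ 4

/-- The covariance of an entry of the Gram matrices on subcarriers `ω` and `ω'`. -/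
noncomputable def gramCov {B W : ℕ} (L : ℕ) (S : Matrix (Fin B) (Fin B) ℂ) (σ : ℝ)
    (ω ω' : Fin W) : ℝ :=
  ∑ a, ∑ b, ‖channelCov L S σ ω ω' a b‖ ^ 2

lemma gramCov_of_ne {B W : ℕ} (L : ℕ) (S : Matrix (Fin B) (Fin B) ℂ) (σ : ℝ) {ω ω' : Fin W}
    (h : ω ≠ ω') : gramCov L S σ ω ω' = fejerCorr W L ((ω : ℝ) - (ω' : ℝ)) * corrEnergy S := by
  simp [gramCov, corrEnergy, channelCov, h, mul_pow, norm_phaseCorr_sq, Finset.mul_sum]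

lemma normCorr_self {B : ℕ} (S : Matrix (Fin B) (Fin B) ℂ) (a : Fin B) :
    normCorr S a a = ((∑ c, ‖S a c‖ ^ 2) / B : ℝ) := by
  simp only [normCorr, Complex.conj_mul']
  push_cast
  rfl

/-- Errors change only the diagonal covariances, where `normCorr S a a` is real, so expanding the
square of `normCorr S a a + σ ^ 2` produces `errPower`. -/
lemma gramCov_self {B W L : ℕ} (hL : L ≠ 0) (S : Matrix (Fin B) (Fin B) ℂ) (σ : ℝ) (ω : Fin W) :
    gramCov L S σ ω ω = corrEnergy S + errPower S σ := by
  have h (a b : Fin B) : ‖channelCov L S σ ω ω a b‖ ^ 2 = ‖normCorr S a b‖ ^ 2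
      + if a = b then 2 * σ ^ 2 * ((∑ c, ‖S a c‖ ^ 2) / B) + σ ^ 4 else 0 := by
    by_cases hab : a = b
    · subst hab
      simp only [channelCov, phaseCorr_self W hL, normCorr_self, if_true, and_self, one_mul]
      rw [← Complex.ofReal_pow, ← Complex.ofReal_add, Complex.norm_real, Complex.norm_real,
        Real.norm_eq_abs, Real.norm_eq_abs, sq_abs, sq_abs]
      ring
    · simp [channelCov, phaseCorr_self W hL, hab]
  simp only [gramCov, h, Finset.sum_add_distrib, corrEnergy, errPower]
  simp [Finset.sum_add_distrib, Finset.mul_sum]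

/-- A diagonal entry of `S * S` is `1`, so `S` has a nonzero row, whose squared norm gives a
positive diagonal term. -/
lemma corrEnergy_pos {B : ℕ} {δ : ℝ} (hB : 1 ≤ B) (S : Matrix (Fin B) (Fin B) ℂ)
    (hS : S * S = corrMatrix B δ) : 0 < corrEnergy S := by
  obtain ⟨a, c, hac⟩ : ∃ a c, S a c ≠ 0 := by
    by_contra! h
    have h0 := congr_fun (congr_fun hS ⟨0, hB⟩) ⟨0, hB⟩
    simp [corrMatrix, Matrix.mul_apply, h] at h0
  have hpos : 0 < (∑ c, ‖S a c‖ ^ 2) / (B : ℝ) := by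
    refine div_pos (Finset.sum_pos' (fun _ _ => by positivity) ⟨c, Finset.mem_univ _, ?_⟩) ?_
    · have := norm_pos_iff.mpr hac
      positivity
    · exact_mod_cast hB
  refine Finset.sum_pos' (fun _ _ => by positivity) ⟨a, Finset.mem_univ _, ?_⟩
  refine Finset.sum_pos' (fun _ _ => by positivity) ⟨a, Finset.mem_univ _, ?_⟩
  rw [normCorr_self, Complex.norm_real, Real.norm_eq_abs, sq_abs]
  positivity

lemma errPower_nonneg {B : ℕ} (S : Matrix (Fin B) (Fin B) ℂ) (σ : ℝ) : 0 ≤ errPower S σ := by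
  unfold errPower
  positivity

lemma errPower_eq_zero_iff {B : ℕ} (hB : 1 ≤ B) (S : Matrix (Fin B) (Fin B) ℂ) (σ : ℝ) :
    errPower S σ = 0 ↔ σ = 0 := by
  refine ⟨fun h => ?_, fun h => by simp [errPower, h]⟩
  by_contra hσ
  have : (0 : ℝ) < B := by exact_mod_cast hB
  have : 0 < errPower S σ := by
    unfold errPower
    positivity
  exact this.ne' h

lemma epsCSI_eq_zero_iff (B : ℕ) (σ : ℝ) : epsCSI B σ = 0 ↔ σ = 0 := by
  have : 2 + (B : ℝ) * σ ^ 2 ≠ 0 := by positivity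
  simp [epsCSI, this]

/-! ### Second moments of the Gram matrices -/

section Moments

variable {Ω : Type*} [MeasurableSpace Ω] {P : Measure Ω} {B U W L : ℕ}
  {X : Fin L → Ω → Matrix (Fin B) (Fin U) ℂ} {E : Fin W → Ω → Matrix (Fin B) (Fin U) ℂ}

lemma IsChannelModel.law (h : IsChannelModel P X E) (i : EntryIndex B U W L) :
    HasLaw (fun s => Sum.elim (fun t => X t.1 s t.2.1 t.2.2) (fun t => E t.1 s t.2.1 t.2.2) i)
      (complexGaussian (entryVar B U W L i)) P := by
  rcases i with i | i
  · exact h.law_tap _ _ _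
  · exact h.law_err _ _ _

lemma IsChannelModel.hasAllMoments_freqChannel (h : IsChannelModel P X E)
    (S : Matrix (Fin B) (Fin B) ℂ) (σ : ℝ) (ω : Fin W) (a : Fin B) (m : Fin U) :
    HasAllMoments P fun s => freqChannel S σ (fun ℓ => X ℓ s) (fun v => E v s) ω a m := by
  simp_rw [freqChannel_apply]
  exact hasAllMoments_linearForm h.law _

lemma gram_apply (S : Matrix (Fin B) (Fin B) ℂ) (σ : ℝ)
    (X : Fin L → Matrix (Fin B) (Fin U) ℂ) (E : Fin W → Matrix (Fin B) (Fin U) ℂ) (ω : Fin W)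
    (m n : Fin U) : gram S σ X E ω m n
      = ∑ a, conj (freqChannel S σ X E ω a m) * freqChannel S σ X E ω a n := by
  simp [gram, Matrix.mul_apply]

lemma IsChannelModel.hasAllMoments_gram (h : IsChannelModel P X E)
    (S : Matrix (Fin B) (Fin B) ℂ) (σ : ℝ) (ω : Fin W) (m n : Fin U) :
    HasAllMoments P fun s => gram S σ (fun ℓ => X ℓ s) (fun v => E v s) ω m n := by
  simp_rw [gram_apply]
  exact .sum _ fun a _ => (h.hasAllMoments_freqChannel S σ ω a m).conj_comp.mul
    (h.hasAllMoments_freqChannel S σ ω a n)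

/-- The second moments of a Gram entry: the first term does not depend on the subcarriers. -/
lemma IsChannelModel.integral_gram_mul_conj_gram (h : IsChannelModel P X E) (hL : L ≠ 0)
    (S : Matrix (Fin B) (Fin B) ℂ) (σ : ℝ) (ω ω' : Fin W) (m n : Fin U) :
    ∫ s, gram S σ (fun ℓ => X ℓ s) (fun v => E v s) ω m n
        * conj (gram S σ (fun ℓ => X ℓ s) (fun v => E v s) ω' m n) ∂P
      = (if m = n then (∑ a, (normCorr S a a + (σ : ℂ) ^ 2)) ^ 2 else 0)
        + (gramCov L S σ ω ω' : ℂ) := by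
  have hm (ω a m) := h.hasAllMoments_freqChannel S σ ω a m
  have hexp (s : Ω) : gram S σ (fun ℓ => X ℓ s) (fun v => E v s) ω m n
        * conj (gram S σ (fun ℓ => X ℓ s) (fun v => E v s) ω' m n)
      = ∑ a, ∑ b, conj (freqChannel S σ (fun ℓ => X ℓ s) (fun v => E v s) ω a m)
          * freqChannel S σ (fun ℓ => X ℓ s) (fun v => E v s) ω a n
          * (freqChannel S σ (fun ℓ => X ℓ s) (fun v => E v s) ω' b m
            * conj (freqChannel S σ (fun ℓ => X ℓ s) (fun v => E v s) ω' b n)) := by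
    rw [gram_apply, gram_apply, map_sum, Finset.sum_mul_sum]
    simp
  have hint (a b : Fin B) := ((hm ω a m).conj_comp.mul (hm ω a n)).mul
    ((hm ω' b m).mul (hm ω' b n).conj_comp)
  have hwick (a b : Fin B) : ∫ s, conj (freqChannel S σ (fun ℓ => X ℓ s) (fun v => E v s) ω a m)
          * freqChannel S σ (fun ℓ => X ℓ s) (fun v => E v s) ω a n
          * (freqChannel S σ (fun ℓ => X ℓ s) (fun v => E v s) ω' b m
            * conj (freqChannel S σ (fun ℓ => X ℓ s) (fun v => E v s) ω' b n)) ∂P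
      = (if m = n then (normCorr S a a + (σ : ℂ) ^ 2) * (normCorr S b b + (σ : ℂ) ^ 2) else 0)
        + ((‖channelCov L S σ ω ω' a b‖ ^ 2 : ℝ) : ℂ) := by
    simp_rw [freqChannel_apply]
    rw [integral_linearForms h.indep h.law]
    simp only [formCov_channelCoef]
    -- Pairing within each Gram entry gives the product of means; pairing across the two entries
    -- gives a covariance times its conjugate.
    congr 1
    · by_cases hmn : m = n
      · simp [hmn, channelCov, phaseCorr_self W hL]
      · simp [hmn]
    · simp only [if_true]
      rw [← conj_channelCov S σ ω ω' a b, Complex.mul_conj']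
      push_cast
      rfl
  simp_rw [hexp]
  rw [integral_finsetSum _ fun a _ => (HasAllMoments.sum _ fun b _ => hint a b).integrable]
  simp_rw [integral_finsetSum _ fun b _ => (hint _ b).integrable, hwick]
  simp only [Finset.sum_add_distrib (f := fun b => ite _ _ _)]
  rw [Finset.sum_add_distrib]
  congr 1
  · split_ifs
    · rw [← Finset.sum_mul_sum, ← sq]
    · simp
  · simp [gramCov]

/-- The mean square of a combination of Gram entries with real weights of sum zero. -/
lemma IsChannelModel.integral_norm_sum_gram_sq (h : IsChannelModel P X E) (hL : L ≠ 0)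
    (S : Matrix (Fin B) (Fin B) ℂ) (σ : ℝ) {J : Type*} [Fintype J] (w : J → Fin W) (c : J → ℝ)
    (hc : ∑ j, c j = 0) (m n : Fin U) :
    ∫ s, ‖∑ j, (c j : ℂ) * gram S σ (fun ℓ => X ℓ s) (fun v => E v s) (w j) m n‖ ^ 2 ∂P
      = ∑ j, ∑ j', c j * c j' * gramCov L S σ (w j) (w j') := by
  have hm (ω) := h.hasAllMoments_gram S σ ω m n
  apply Complex.ofReal_injective
  rw [← integral_complex_ofReal]
  have hexp (s : Ω) :
      ((‖∑ j, (c j : ℂ) * gram S σ (fun ℓ => X ℓ s) (fun v => E v s) (w j) m n‖ ^ 2 : ℝ) : ℂ)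
      = ∑ j, ∑ j', ((c j : ℂ) * c j') * (gram S σ (fun ℓ => X ℓ s) (fun v => E v s) (w j) m n
        * conj (gram S σ (fun ℓ => X ℓ s) (fun v => E v s) (w j') m n)) := by
    rw [Complex.ofReal_pow, ← Complex.mul_conj', map_sum, Finset.sum_mul_sum]
    refine Finset.sum_congr rfl fun j _ => Finset.sum_congr rfl fun j' _ => ?_
    simp only [map_mul, Complex.conj_ofReal]
    ring
  have hint (j j' : J) := ((hm (w j)).mul (hm (w j')).conj_comp).const_mul ((c j : ℂ) * c j')
  simp_rw [hexp]
  rw [integral_finsetSum _ fun j _ => (HasAllMoments.sum _ fun j' _ => hint j j').integrable]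
  simp_rw [integral_finsetSum _ fun j' _ => (hint _ j').integrable, integral_const_mul,
    h.integral_gram_mul_conj_gram hL, mul_add, Finset.sum_add_distrib, ← Finset.sum_mul,
    ← Finset.mul_sum]
  -- The constant part is multiplied by the sum of the weights, which is zero.
  rw [← Complex.ofReal_sum, hc]
  simp

end Moments

/-! ### The trigonometric inequality -/

/-- The difference of the two sides vanishes at `t = 1` and is strictly decreasing in `t`: its
derivative is `sin u - 2u cos ((2t - 1) u) ≤ sin u - u < 0`, as the cosine is at least `cos (π/3) =
1/2`. -/
lemma sin_mul_lt_mul_sin {u t : ℝ} (hu : 0 < u) (hu' : u ≤ Real.pi / 3) (ht : 1 / 2 ≤ t)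
    (ht' : t < 1) : Real.sin ((2 * t - 1) * u) < t * Real.sin u := by
  have hanti : StrictAntiOn (fun t : ℝ => t * Real.sin u - Real.sin ((2 * t - 1) * u))
      (Set.Icc (1 / 2) 1) := by
    have hderiv (x : ℝ) : HasDerivAt (fun t : ℝ => t * Real.sin u - Real.sin ((2 * t - 1) * u))
        (1 * Real.sin u - Real.cos ((2 * x - 1) * u) * ((2 * 1) * u)) x :=
      ((hasDerivAt_id x).mul_const _).sub
        ((((hasDerivAt_id x).const_mul 2).sub_const 1).mul_const u).sin
    refine strictAntiOn_of_deriv_neg (convex_Icc _ _) (by fun_prop) fun x hx => ?_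
    rw [interior_Icc] at hx
    rw [(hderiv x).deriv]
    have h1 : Real.cos (Real.pi / 3) ≤ Real.cos ((2 * x - 1) * u) := by
      refine Real.cos_le_cos_of_nonneg_of_le_pi ?_ ?_ ?_
      · exact mul_nonneg (by linarith [hx.1]) hu.le
      · linarith [Real.pi_pos]
      · nlinarith [hx.2]
    rw [Real.cos_pi_div_three] at h1
    nlinarith [Real.sin_lt hu]
  have h := hanti ⟨ht, ht'.le⟩ ⟨by norm_num, le_rfl⟩ ht'
  norm_num at h
  linarith

lemma cos_sub_cos_lt {a b y : ℝ} (ha : 0 < a) (hab : a ≤ b) (hy : y ≠ 0)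
    (hy' : |y| * (a + b) ≤ 2 * Real.pi / 3) :
    Real.cos (y * a) - Real.cos (y * b) < b / (a + b) * (1 - Real.cos (y * (a + b))) := by
  wlog hpos : 0 < y generalizing y
  · have := this (y := -y) (by simpa using hy) (by simpa using hy')
      (by rcases lt_or_gt_of_ne hy with h | h <;> [linarith; exact absurd h hpos])
    simpa [neg_mul, Real.cos_neg] using this
  rw [abs_of_pos hpos] at hy'
  -- In half-angle form the two sides are `2 sin u sin ((2t - 1) u)` and `2 t (sin u)²`, with common
  -- positive factor `2 sin u`.
  set u := y * (a + b) / 2 with hu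
  set t := b / (a + b) with ht
  have hd : 0 < a + b := by linarith
  have hb : b = t * (a + b) := by rw [ht]; field_simp
  have hu0 : 0 < u := by positivity
  have hs := sin_mul_lt_mul_sin hu0 (by linarith)
    (show 1 / 2 ≤ t by rw [ht, div_le_div_iff₀ two_pos hd]; linarith)
    (show t < 1 by rw [ht, div_lt_one hd]; linarith)
  have hsin : 0 < Real.sin u :=
    Real.sin_pos_of_pos_of_lt_pi hu0 (by linarith [Real.pi_pos])
  have h1 : Real.cos (y * a) - Real.cos (y * b) = 2 * Real.sin u * Real.sin ((2 * t - 1) * u) := by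
    rw [Real.cos_sub_cos]
    have e1 : (y * a + y * b) / 2 = u := by rw [hu]; ring
    have e2 : (y * a - y * b) / 2 = -((2 * t - 1) * u) := by
      have : (2 * t - 1) * (a + b) = b - a := by linear_combination -2 * hb
      rw [hu]
      linear_combination (y / 2) * this
    rw [e1, e2, Real.sin_neg]
    ring
  have h2 : 1 - Real.cos (y * (a + b)) = 2 * Real.sin u ^ 2 := by
    rw [show y * (a + b) = 2 * u by rw [hu]; ring, Real.cos_two_mul, Real.cos_sq']
    ring
  rw [h1, h2]
  nlinarith

/-! ### The gap inequality for the Fejér kernel -/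

lemma fejerCorr_neg (W L : ℕ) (x : ℝ) : fejerCorr W L (-x) = fejerCorr W L x := by
  simp [fejerCorr]

lemma fejerCorr_abs (W L : ℕ) (x : ℝ) : fejerCorr W L |x| = fejerCorr W L x := by
  rcases abs_choice x with h | h <;> rw [h]
  exact fejerCorr_neg W L x

lemma fejerCorr_one (W : ℕ) (x : ℝ) : fejerCorr W 1 x = 1 := by
  simp [fejerCorr]

lemma fejerCorr_gap {W L : ℕ} (hL : 0 < L) (x y z c : ℝ) :
    c * (1 - fejerCorr W L z) - (fejerCorr W L x - fejerCorr W L y)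
      = (∑ ℓ : Fin L, ∑ ℓ' : Fin L, (c * (1 - Real.cos (2 * Real.pi * ((ℓ : ℝ) - ℓ') / W * z))
        - (Real.cos (2 * Real.pi * ((ℓ : ℝ) - ℓ') / W * x)
          - Real.cos (2 * Real.pi * ((ℓ : ℝ) - ℓ') / W * y)))) / L ^ 2 := by
  have hL' : (L : ℝ) ^ 2 ≠ 0 := by positivity
  have hF (x : ℝ) : fejerCorr W L x * L ^ 2
      = ∑ ℓ : Fin L, ∑ ℓ' : Fin L, Real.cos (2 * Real.pi * ((ℓ : ℝ) - ℓ') / W * x) :=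
    div_mul_cancel₀ _ hL'
  rw [eq_div_iff hL']
  simp only [Finset.sum_sub_distrib, ← Finset.mul_sum, Finset.sum_const, Finset.card_univ,
    Fintype.card_fin, nsmul_eq_mul, ← hF]
  ring

section Gap

variable {W L : ℕ} {a b : ℝ}

/-- Since `|ℓ - ℓ'| ≤ L`, spacing at most `W / (3L)` keeps every phase within `2π/3`, twice the
bound `π/3` on the half-angle. -/
lemma abs_phase_mul_le (hW : 0 < W) (hd : a + b ≤ (W : ℝ) / (3 * L)) (hab : 0 < a + b)
    (ℓ ℓ' : Fin L) : |2 * Real.pi * ((ℓ : ℝ) - ℓ') / W| * (a + b) ≤ 2 * Real.pi / 3 := by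
  have hL : (0 : ℝ) < L := by exact_mod_cast ℓ.pos
  have hW' : (0 : ℝ) < W := by exact_mod_cast hW
  have h1 : |(ℓ : ℝ) - ℓ'| ≤ L := by
    have h2 : (ℓ : ℝ) < L := by exact_mod_cast ℓ.2
    have h3 : (ℓ' : ℝ) < L := by exact_mod_cast ℓ'.2
    have h4 : (0 : ℝ) ≤ (ℓ : ℕ) := by positivity
    have h5 : (0 : ℝ) ≤ (ℓ' : ℕ) := by positivity
    rw [abs_le]
    constructor <;> linarith
  rw [abs_div, abs_mul, abs_of_pos Real.two_pi_pos, abs_of_pos hW']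
  calc 2 * Real.pi * |(ℓ : ℝ) - ℓ'| / W * (a + b)
      ≤ 2 * Real.pi * L / W * (W / (3 * L)) := by gcongr
    _ = 2 * Real.pi / 3 := by field_simp

lemma fejerCorr_gap_term_nonneg (hW : 0 < W) (ha : 0 < a) (hab : a ≤ b)
    (hd : a + b ≤ (W : ℝ) / (3 * L)) (ℓ ℓ' : Fin L) :
    0 ≤ b / (a + b) * (1 - Real.cos (2 * Real.pi * ((ℓ : ℝ) - ℓ') / W * (a + b)))
        - (Real.cos (2 * Real.pi * ((ℓ : ℝ) - ℓ') / W * a)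
          - Real.cos (2 * Real.pi * ((ℓ : ℝ) - ℓ') / W * b)) := by
  by_cases h : 2 * Real.pi * ((ℓ : ℝ) - ℓ') / W = 0
  · simp [h]
  · exact (sub_pos.mpr (cos_sub_cos_lt ha hab h (abs_phase_mul_le hW hd (by linarith) _ _))).le

lemma fejerCorr_gap_nonneg (hW : 0 < W) (hL : 0 < L) (ha : 0 < a) (hab : a ≤ b)
    (hd : a + b ≤ (W : ℝ) / (3 * L)) :
    0 ≤ b / (a + b) * (1 - fejerCorr W L (a + b)) - (fejerCorr W L a - fejerCorr W L b) := by
  rw [fejerCorr_gap hL]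
  exact div_nonneg (Finset.sum_nonneg fun ℓ _ => Finset.sum_nonneg fun ℓ' _ =>
    fejerCorr_gap_term_nonneg hW ha hab hd ℓ ℓ') (by positivity)

lemma fejerCorr_gap_pos (hW : 0 < W) (hL : 1 < L) (ha : 0 < a) (hab : a ≤ b)
    (hd : a + b ≤ (W : ℝ) / (3 * L)) :
    0 < b / (a + b) * (1 - fejerCorr W L (a + b)) - (fejerCorr W L a - fejerCorr W L b) := by
  rw [fejerCorr_gap (by omega)]
  refine div_pos ?_ (by positivity)
  -- The tap pair `(1, 0)` has nonzero frequency, hence a strictly positive term.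
  refine Finset.sum_pos' (fun ℓ _ => Finset.sum_nonneg fun ℓ' _ =>
    fejerCorr_gap_term_nonneg hW ha hab hd ℓ ℓ') ⟨⟨1, hL⟩, Finset.mem_univ _, ?_⟩
  refine Finset.sum_pos' (fun ℓ' _ => fejerCorr_gap_term_nonneg hW ha hab hd _ ℓ')
    ⟨⟨0, by omega⟩, Finset.mem_univ _, ?_⟩
  refine sub_pos.mpr (cos_sub_cos_lt ha hab ?_ (abs_phase_mul_le hW hd (by linarith) _ _))
  simp [Real.pi_ne_zero, hW.ne']

lemma fejerCorr_gap_eq_zero_iff (hW : 0 < W) (hL : 0 < L) (ha : 0 < a) (hab : a ≤ b)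
    (hd : a + b ≤ (W : ℝ) / (3 * L)) :
    b / (a + b) * (1 - fejerCorr W L (a + b)) - (fejerCorr W L a - fejerCorr W L b) = 0
      ↔ L = 1 := by
  refine ⟨fun h => ?_, fun h => by subst h; simp [fejerCorr_one]⟩
  by_contra hne
  exact (fejerCorr_gap_pos hW (by omega) ha hab hd).ne' h

end Gap

/-! ### Closed forms of the two errors -/

section MSE

variable {Ω : Type*} [MeasurableSpace Ω] {P : Measure Ω} {B U W L : ℕ}
  {X : Fin L → Ω → Matrix (Fin B) (Fin U) ℂ} {E : Fin W → Ω → Matrix (Fin B) (Fin U) ℂ}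

lemma IsChannelModel.mseZero_eq (h : IsChannelModel P X E) (hL : L ≠ 0)
    (S : Matrix (Fin B) (Fin B) ℂ) (σ : ℝ) {q ω : Fin W} (hq : q ≠ ω) (m n : Fin U) :
    mseZero P S σ X E q ω m n = 2 * (corrEnergy S + errPower S σ)
      - 2 * fejerCorr W L ((q : ℝ) - (ω : ℝ)) * corrEnergy S := by
  have hmse := h.integral_norm_sum_gram_sq hL S σ ![q, ω] ![1, -1] (by simp) m n
  simp only [Fin.sum_univ_two, Matrix.cons_val_zero, Matrix.cons_val_one, gramCov_self hL,
    gramCov_of_ne L S σ hq, gramCov_of_ne L S σ hq.symm] at hmse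
  rw [← neg_sub (q : ℝ) (ω : ℝ), fejerCorr_neg] at hmse
  rw [mseZero, entryMSE]
  simp only [Complex.ofReal_one, Complex.ofReal_neg, one_mul, neg_mul, ← sub_eq_add_neg] at hmse
  rw [hmse]
  ring

lemma IsChannelModel.mseOne_eq (h : IsChannelModel P X E) (hL : L ≠ 0)
    (S : Matrix (Fin B) (Fin B) ℂ) (σ : ℝ) {p q ω : Fin W} (hpω : p < ω) (hωq : ω < q)
    (m n : Fin U) {t : ℝ} (ht : t = ((q : ℝ) - (ω : ℝ)) / ((q : ℝ) - (p : ℝ))) :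
    mseOne P S σ X E p q ω m n
      = (t ^ 2 + (1 - t) ^ 2 + 1) * (corrEnergy S + errPower S σ)
        + 2 * (t * (1 - t) * fejerCorr W L ((q : ℝ) - (p : ℝ))
          - t * fejerCorr W L ((ω : ℝ) - (p : ℝ))
          - (1 - t) * fejerCorr W L ((q : ℝ) - (ω : ℝ))) * corrEnergy S := by
  have hmse := h.integral_norm_sum_gram_sq hL S σ ![p, q, ω] ![t, 1 - t, -1]
    (by simp [Fin.sum_univ_three]) m n
  simp only [Fin.sum_univ_three, Matrix.cons_val_zero, Matrix.cons_val_one, Matrix.cons_val,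
    gramCov_self hL, gramCov_of_ne L S σ hpω.ne, gramCov_of_ne L S σ hpω.ne',
    gramCov_of_ne L S σ hωq.ne, gramCov_of_ne L S σ hωq.ne',
    gramCov_of_ne L S σ (hpω.trans hωq).ne, gramCov_of_ne L S σ (hpω.trans hωq).ne'] at hmse
  rw [← neg_sub (q : ℝ) (ω : ℝ), fejerCorr_neg, ← neg_sub (q : ℝ) (p : ℝ), fejerCorr_neg,
    ← neg_sub (ω : ℝ) (p : ℝ), fejerCorr_neg] at hmse
  rw [mseOne, entryMSE]
  simp only [linInterp, ← ht, Matrix.add_apply, Matrix.smul_apply, smul_eq_mul]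
  simp only [Complex.ofReal_one, Complex.ofReal_neg, one_mul, neg_mul, ← sub_eq_add_neg] at hmse
  rw [hmse]
  ring

end MSE

/-! ### Nearest base point and conclusion -/

/-- A nearest base point lies at the distance of the nearer neighbour. -/
lemma IsNearest.abs_sub_eq {K W : ℕ} {p : Fin (K + 1) → Fin W} (hp : StrictMono p) {k : Fin K}
    {ω : Fin W} (h₁ : p k.castSucc < ω) (h₂ : ω < p k.succ) {i : Fin (K + 1)}
    (hi : IsNearest p ω i) :
    |((p i : ℕ) : ℝ) - (ω : ℝ)|
      = min ((ω : ℝ) - (p k.castSucc : ℝ)) ((p k.succ : ℝ) - (ω : ℝ)) := by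
  have key : |((p i : ℕ) : ℤ) - (ω : ℤ)|
      = min ((ω : ℤ) - (p k.castSucc : ℤ)) ((p k.succ : ℤ) - (ω : ℤ)) := by
    have e1 := hi k.castSucc
    have e2 := hi k.succ
    rw [Fin.lt_def] at h₁ h₂
    rw [abs_of_neg (by omega : ((p k.castSucc : ℕ) : ℤ) - (ω : ℤ) < 0)] at e1
    rw [abs_of_pos (by omega : 0 < ((p k.succ : ℕ) : ℤ) - (ω : ℤ))] at e2
    rcases le_or_gt i k.castSucc with h | h
    · have h3 := hp.monotone h
      rw [Fin.le_def] at h3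
      rw [abs_of_neg (by omega : ((p i : ℕ) : ℤ) - (ω : ℤ) < 0)] at *
      omega
    · have h3 := hp.monotone (Fin.castSucc_lt_iff_succ_le.mp h)
      rw [Fin.le_def] at h3
      rw [abs_of_pos (by omega : 0 < ((p i : ℕ) : ℤ) - (ω : ℤ))] at *
      omega
  exact_mod_cast key

theorem corollary3 {Ω : Type*} [MeasurableSpace Ω] (P : Measure Ω) [IsProbabilityMeasure P]
    (B U W L : ℕ) (hB : 1 ≤ B) (hL : 1 ≤ L) (hLW : L ≤ W)
    (δ σ : ℝ) (hδ : δ ^ 2 ≤ 1) (hσ : 0 ≤ σ)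
    (S : Matrix (Fin B) (Fin B) ℂ) (hS : S * S = corrMatrix B δ)
    (X : Fin L → Ω → Matrix (Fin B) (Fin U) ℂ) (E : Fin W → Ω → Matrix (Fin B) (Fin U) ℂ)
    (hXE : IsChannelModel P X E)
    (K : ℕ) (p : Fin (K + 1) → Fin W) (hp : StrictMono p) (k : Fin K)
    (hd : ((p k.succ).val : ℝ) - ((p k.castSucc).val : ℝ) ≤ (W : ℝ) / (3 * (L : ℝ)))
    (ω : Fin W) (hω₁ : p k.castSucc < ω) (hω₂ : ω < p k.succ)
    (i : Fin (K + 1)) (hi : IsNearest p ω i) (m n : Fin U) :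
    mseOne P S σ X E (p k.castSucc) (p k.succ) ω m n ≤ mseZero P S σ X E (p i) ω m n ∧
      (mseOne P S σ X E (p k.castSucc) (p k.succ) ω m n = mseZero P S σ X E (p i) ω m n ↔
        L = 1 ∧ epsCSI B σ = 0) := by
  have hL0 : 0 < L := hL
  have hW : 0 < W := ω.pos
  set a : ℝ := (ω : ℝ) - (p k.castSucc : ℝ) with ha_def
  set b : ℝ := (p k.succ : ℝ) - (ω : ℝ) with hb_def
  have ha : 0 < a := sub_pos.mpr (by exact_mod_cast hω₁)
  have hb : 0 < b := sub_pos.mpr (by exact_mod_cast hω₂)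
  have hsum : (p k.succ : ℝ) - (p k.castSucc : ℝ) = a + b := by rw [ha_def, hb_def]; ring
  have hdist : |((p i : ℕ) : ℝ) - (ω : ℝ)| = min a b := hi.abs_sub_eq hp hω₁ hω₂
  have hne : p i ≠ ω := by
    intro h
    rw [h, sub_self, abs_zero] at hdist
    exact (lt_min ha hb).ne hdist
  have hone := hXE.mseOne_eq hL0.ne' S σ hω₁ hω₂ m n rfl
  have hzero := hXE.mseZero_eq hL0.ne' S σ hne m n
  rw [← fejerCorr_abs, hdist] at hzero
  rw [hsum] at hone hd
  simp only [← ha_def, ← hb_def] at hone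
  have hq := corrEnergy_pos hB S hS
  have hε := errPower_nonneg S σ
  have hab : 0 < a + b := by linarith
  have hμ : 1 - b / (a + b) = a / (a + b) := by field_simp; ring
  -- `Δ` is the Fejér gap, with the distance to the nearer neighbour as its first argument; the two
  -- cases exchange `a` and `b`.
  obtain ⟨ν, Δ, hν, hΔ, hΔ0, hgap⟩ : ∃ ν Δ : ℝ, 0 < ν ∧ 0 ≤ Δ ∧ (Δ = 0 ↔ L = 1) ∧
      mseZero P S σ X E (p i) ω m n - mseOne P S σ X E (p k.castSucc) (p k.succ) ω m n
        = 2 * (b / (a + b)) * (a / (a + b)) * errPower S σ + ν * Δ := by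
    rcases le_total a b with h | h
    · refine ⟨2 * (a / (a + b)) * corrEnergy S, _, by positivity,
        fejerCorr_gap_nonneg hW hL0 ha h hd, fejerCorr_gap_eq_zero_iff hW hL0 ha h hd, ?_⟩
      rw [hzero, hone, min_eq_left h, ← hμ]
      ring
    · rw [add_comm a b] at hd
      refine ⟨2 * (b / (a + b)) * corrEnergy S, _, by positivity,
        fejerCorr_gap_nonneg hW hL0 hb h hd, fejerCorr_gap_eq_zero_iff hW hL0 hb h hd, ?_⟩
      rw [hzero, hone, min_eq_right h, add_comm b a, ← hμ]
      ring
  have hc : 0 < 2 * (b / (a + b)) * (a / (a + b)) := by positivity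
  refine ⟨sub_nonneg.mp (hgap ▸ by positivity), ?_⟩
  rw [epsCSI_eq_zero_iff, ← errPower_eq_zero_iff hB S σ, ← hΔ0, eq_comm, ← sub_eq_zero, hgap,
    add_eq_zero_iff_of_nonneg (by positivity) (by positivity), mul_eq_zero_iff_left hc.ne',
    mul_eq_zero_iff_left hν.ne', and_comm]
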